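/- All matrices have entries $0$ and $1$. A matrix $A$ contains a matrix $P$ if some submatrix of $A$ (rows and columns kept in order, not necessarily contiguous) equals $P$ or can be turned into $P$ by changing some ones to zeroes; otherwise $A$ avoids $P$. $A$ is saturating for $P$ if $A$ avoids $P$ but changing any single zero of $A$ to a one creates a copy of $P$. Let $\mathrm{sat}(n,P)$ be the minimum number of ones in an $n\times n$ matrix that is saturating for $P$. A $k\times k$ permutation matrix is a $k\times k$ matrix with exactly one one in each row and each column. Below, rows and columns are split into nonempty contiguous sets, numbered from top to bottom ($R_1,R_2,\dots$) and from left to right ($C_1,C_2,\dots$); $R_i\times C_j$ denotes the corresponding submatrix. - Class 1: permutation matrices for which the rows split into $R_1,R_2$ and the columns into $C_1,C_2$ such that $R_1\times C_1$ and $R_2\times C_2$ contain ones, $R_2\times C_1$ contains none, and $R_1\times C_2$ contains at most two ones; if it contains two, they are in adjacent rows. - Class 2: permutation matrices for which the rows split into $R_1,R_2,R_3$ and the columns into $C_1,C_2$ such that $R_1\times C_2$ and $R_3\times C_2$ contain ones, $R_2\times C_1$ contains at least two ones, $R_1\times C_1$ and $R_3\times C_1$ contain none, and $R_2\times C_2$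 contains at most two ones; if it contains two, they are in adjacent rows. - Class 3: matrices obtained from an element $X$ of Class 2 (with a splitting as above) by moving the row of $X$ that contains the rightmost one of $R_2\times C_1$ in front of the first row. - Class 4: permutation matrices for which the rows split into $R_1,R_2,R_3$ and the columns into $C_1,C_2,C_3$ such that $R_1\times C_2$, $R_2\times C_1$, $R_2\times C_3$ and $R_3\times C_2$ all contain ones, and there are no ones outside these four submatrices. A permutation matrix $P$ is ordinary if no matrix obtained from $P$ by a (possibly empty) sequence of vertical or horizontal reflections and $90$ degree rotations lies in any of the Classes 1 to 4. **Theorem.** Every ordinary $k\times k$ permutation matrix $P$, $k\ge 1$, has $\mathrm{sat}(n,P)=O(1)$ as $n\to\infty$. Moreover, there is an absolute constant $K$ such that $\mathrm{sat}(n,P)\le K k^2$ for every $k\ge 1$, every ordinary $k\times k$ permutation matrix $P$ and every $n\ge 0$. -/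

import Mathlib

open Filter Asymptotics

/-- A 0-1 matrix with `m` rows and `n` columns; the entry `true` is a one and `false` is a zero.
Row `0` is the top row and column `0` is the leftmost column. -/
abbrev ZeroOneMatrix (m n : ℕ) : Type := Matrix (Fin m) (Fin n) Bool

namespace ZeroOneMatrix

/-- `A` contains `P`: some submatrix of `A` (rows and columns chosen in order, not necessarily
contiguous) has the dimensions of `P` and is `P` or becomes `P` by changing ones to zeroes. -/
def Contains {m n p q : ℕ} (A : ZeroOneMatrix m n) (P : ZeroOneMatrix p q) : Prop :=
  ∃ (r : Fin p → Fin m) (c : Fin q → Fin n), StrictMono r ∧ StrictMono c ∧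
    ∀ i j, P i j = true → A (r i) (c j) = true

/-- `A` avoids `P`. -/
def Avoids {m n p q : ℕ} (A : ZeroOneMatrix m n) (P : ZeroOneMatrix p q) : Prop :=
  ¬ Contains A P

/-- The matrix `A` with entry `(i, j)` changed to a one. -/
def setOne {m n : ℕ} (A : ZeroOneMatrix m n) (i : Fin m) (j : Fin n) : ZeroOneMatrix m n :=
  fun a b => if a = i ∧ b = j then true else A a b

/-- `A` is saturating for `P`: it avoids `P`, but changing any zero to a one creates a copy
of `P`. -/
def Saturating {m n p q : ℕ} (A : ZeroOneMatrix m n) (P : ZeroOneMatrix p q) : Prop :=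
  Avoids A P ∧ ∀ i j, A i j = false → Contains (setOne A i j) P

/-- The number of ones of `A`. -/
def numOnes {m n : ℕ} (A : ZeroOneMatrix m n) : ℕ :=
  (Finset.univ.filter fun x : Fin m × Fin n => A x.1 x.2 = true).card

/-- The saturation function: the minimum number of ones in an `n × n` matrix that is
saturating for `P`. -/
noncomputable def sat {p q : ℕ} (n : ℕ) (P : ZeroOneMatrix p q) : ℕ :=
  sInf {t : ℕ | ∃ A : ZeroOneMatrix n n, Saturating A P ∧ numOnes A = t}

/-- If `P` has at least one one, the minimum in the definition of `sat` is attained. -/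
theorem sat_isLeast {p q : ℕ} (n : ℕ) (P : ZeroOneMatrix p q) (hP : ∃ i j, P i j = true) :
    IsLeast {t : ℕ | ∃ A : ZeroOneMatrix n n, Saturating A P ∧ numOnes A = t} (sat n P) := by
  have hne : {t : ℕ | ∃ A : ZeroOneMatrix n n, Saturating A P ∧ numOnes A = t}.Nonempty := by
    obtain ⟨A, hA, hmax⟩ := Set.exists_max_image {A : ZeroOneMatrix n n | Avoids A P} numOnes
      (Set.toFinite _) ⟨fun _ _ => false, by
        rintro ⟨r, c, -, -, h⟩
        obtain ⟨i, j, hij⟩ := hP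
        simpa using h i j hij⟩
    refine ⟨numOnes A, A, ⟨hA, fun i j hij => ?_⟩, rfl⟩
    by_contra hc
    have hle := hmax (setOne A i j) hc
    have hlt : numOnes A < numOnes (setOne A i j) := by
      apply Finset.card_lt_card
      refine Finset.ssubset_iff_of_subset ?_ |>.2 ⟨(i, j), ?_, ?_⟩
      · intro x hx
        simp only [Finset.mem_filter, Finset.mem_univ, true_and] at hx ⊢
        simp [setOne, hx]
      · simp [setOne]
      · simp [hij]
    omega
  exact ⟨Nat.sInf_mem hne, fun _ ht => Nat.sInf_le ht⟩

/-- A permutation matrix: every row and every column has exactly one one. -/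
def IsPermMatrix {k : ℕ} (P : ZeroOneMatrix k k) : Prop :=
  (∀ i, ∃! j, P i j = true) ∧ ∀ j, ∃! i, P i j = true

/-- Reflection that reverses the order of the rows. -/
def reverseRows {k : ℕ} (P : ZeroOneMatrix k k) : ZeroOneMatrix k k :=
  fun i j => P i.rev j

/-- Reflection that reverses the order of the columns. -/
def reverseCols {k : ℕ} (P : ZeroOneMatrix k k) : ZeroOneMatrix k k :=
  fun i j => P i j.rev

/-- Clockwise rotation by 90 degrees. -/
def rotate {k : ℕ} (P : ZeroOneMatrix k k) : ZeroOneMatrix k k :=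
  fun i j => P j.rev i

/-- `Q` is obtained from `P` by one reflection or one (clockwise) rotation by 90 degrees. -/
def SymmStep {k : ℕ} (P Q : ZeroOneMatrix k k) : Prop :=
  Q = reverseRows P ∨ Q = reverseCols P ∨ Q = rotate P

/-- The rows (or columns) with index in `[a, b)`. -/
def seg (k a b : ℕ) : Finset (Fin k) :=
  Finset.univ.filter fun i => a ≤ i.val ∧ i.val < b

/-- The positions of the ones of `P` in the submatrix restricted to `R × C`. -/
def onesIn {k : ℕ} (P : ZeroOneMatrix k k) (R C : Finset (Fin k)) : Finset (Fin k × Fin k) :=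
  (R ×ˢ C).filter fun x => P x.1 x.2 = true

/-- The set `S` of positions has at most two elements, and if it has two elements, then they are
in adjacent rows. -/
def AtMostTwoAdjacent {k : ℕ} (S : Finset (Fin k × Fin k)) : Prop :=
  S.card ≤ 2 ∧ ∀ x ∈ S, ∀ y ∈ S, x ≠ y → x.1.val + 1 = y.1.val ∨ y.1.val + 1 = x.1.val

/-- Class 1, with `R₁ = [0, a)`, `R₂ = [a, k)`, `C₁ = [0, c)`, `C₂ = [c, k)`. -/
def InClass1 {k : ℕ} (P : ZeroOneMatrix k k) : Prop :=
  IsPermMatrix P ∧ ∃ a c : ℕ, 0 < a ∧ a < k ∧ 0 < c ∧ c < k ∧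
    (onesIn P (seg k 0 a) (seg k 0 c)).Nonempty ∧
    (onesIn P (seg k a k) (seg k c k)).Nonempty ∧
    onesIn P (seg k a k) (seg k 0 c) = ∅ ∧
    AtMostTwoAdjacent (onesIn P (seg k 0 a) (seg k c k))

/-- `P` is an element of Class 2 as witnessed by the splitting
`R₁ = [0, a)`, `R₂ = [a, b)`, `R₃ = [b, k)`, `C₁ = [0, c)`, `C₂ = [c, k)`. -/
def IsClass2Splitting {k : ℕ} (P : ZeroOneMatrix k k) (a b c : ℕ) : Prop :=
  IsPermMatrix P ∧ 0 < a ∧ a < b ∧ b < k ∧ 0 < c ∧ c < k ∧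
    (onesIn P (seg k 0 a) (seg k c k)).Nonempty ∧
    (onesIn P (seg k b k) (seg k c k)).Nonempty ∧
    2 ≤ (onesIn P (seg k a b) (seg k 0 c)).card ∧
    onesIn P (seg k 0 a) (seg k 0 c) = ∅ ∧
    onesIn P (seg k b k) (seg k 0 c) = ∅ ∧
    AtMostTwoAdjacent (onesIn P (seg k a b) (seg k c k))

/-- Class 2. -/
def InClass2 {k : ℕ} (P : ZeroOneMatrix k k) : Prop :=
  ∃ a b c : ℕ, IsClass2Splitting P a b c

/-- The matrix obtained from `X` by deleting row `r` from its position and adding it in front of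
the first row. -/
def moveRowToFront {k : ℕ} (X : ZeroOneMatrix k k) (r : Fin k) : ZeroOneMatrix k k :=
  fun i j =>
    if i.val = 0 then X r j
    else if i.val ≤ r.val then X ⟨i.val - 1, lt_of_le_of_lt (Nat.sub_le _ _) i.isLt⟩ j
    else X i j

/-- Class 3: `P` is obtained from an element `X` of Class 2 by moving to the front the row `r`
of `X` that contains the rightmost one (in column `s`) of the submatrix `R₂ × C₁`. -/
def InClass3 {k : ℕ} (P : ZeroOneMatrix k k) : Prop :=
  ∃ (X : ZeroOneMatrix k k) (a b c : ℕ) (r s : Fin k), IsClass2Splitting X a b c ∧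
    (r, s) ∈ onesIn X (seg k a b) (seg k 0 c) ∧
    (∀ x ∈ onesIn X (seg k a b) (seg k 0 c), x.2 ≤ s) ∧
    P = moveRowToFront X r

/-- Class 4, with `R₁ = [0, a)`, `R₂ = [a, b)`, `R₃ = [b, k)`, `C₁ = [0, c)`, `C₂ = [c, d)`,
`C₃ = [d, k)`. -/
def InClass4 {k : ℕ} (P : ZeroOneMatrix k k) : Prop :=
  IsPermMatrix P ∧ ∃ a b c d : ℕ, 0 < a ∧ a < b ∧ b < k ∧ 0 < c ∧ c < d ∧ d < k ∧
    (onesIn P (seg k 0 a) (seg k c d)).Nonempty ∧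
    (onesIn P (seg k a b) (seg k 0 c)).Nonempty ∧
    (onesIn P (seg k a b) (seg k d k)).Nonempty ∧
    (onesIn P (seg k b k) (seg k c d)).Nonempty ∧
    onesIn P (seg k 0 a) (seg k 0 c) = ∅ ∧
    onesIn P (seg k 0 a) (seg k d k) = ∅ ∧
    onesIn P (seg k a b) (seg k c d) = ∅ ∧
    onesIn P (seg k b k) (seg k 0 c) = ∅ ∧
    onesIn P (seg k b k) (seg k d k) = ∅

/-- A permutation matrix `P` is ordinary if no matrix obtained from it by a (possibly empty)
sequence of reflections and rotations by 90 degrees lies in one of the Classes 1 to 4. -/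
def IsOrdinary {k : ℕ} (P : ZeroOneMatrix k k) : Prop :=
  IsPermMatrix P ∧ ∀ Q : ZeroOneMatrix k k, Relation.ReflTransGen SymmStep P Q →
    ¬ InClass1 Q ∧ ¬ InClass2 Q ∧ ¬ InClass3 Q ∧ ¬ InClass4 Q

end ZeroOneMatrix

namespace ZeroOneMatrix

/-! The construction is a sparse cross of ones in the lattice, first coordinate vertical, with row 0
and column 0 empty. The left arm is `P` without the one of its last column, whose row is laid on row
0; the right arm is `P` without the one of its first column, again with that row on row 0. The top
and bottom arms are the transposed versions. A one added anywhere in row 0 completes the left arm or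
the right arm to a copy of `P`, and column 0 behaves likewise with the top and bottom arms.

If the cross itself avoids `P`, blow up row 0 and column 0 to fill an `n × n` matrix, keeping only
`3k` rows and columns on each side. Any saturating matrix above it has no one in a central row or
column, so at most `(6k)^2` ones (`sat_le_of_not_occursIn`).

The heart is `IsOrdinary.not_occursIn_crossSet`. A copy of `P` in the cross is cut into blocks
according to the arms it meets. All four arms give Class 4; one vertical and one horizontal arm give
Class 1; two opposite arms and a third give Class 2, Class 3 or Class 1, up to symmetry. When only
two opposite arms are available, the shape of the arms matters: in the right arm the rows next to
row 0 stay at -1 and 1, and all other rows are pushed beyond the rows of the left arm. Hence the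
only interleaving is in rows -1 and 1, which come from adjacent rows of `P` since row 0 is empty.
This is the source of the "at most two ones, in adjacent rows" clauses. What is left is a copy that
uses one arm almost alone, and counting then forces a row of `P` onto the empty row 0. -/

variable {k : ℕ} {P : ZeroOneMatrix k k}

/-! ### Symmetries of ordinary matrices -/

theorem IsPermMatrix.row_inj (hP : P.IsPermMatrix) {i i' j : Fin k} (h : P i j = true)
    (h' : P i' j = true) : i = i' :=
  (hP.2 j).unique h h'

theorem IsPermMatrix.col_inj (hP : P.IsPermMatrix) {i j j' : Fin k} (h : P i j = true)
    (h' : P i j' = true) : j = j' :=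
  (hP.1 i).unique h h'

theorem IsOrdinary.symmStep (hP : P.IsOrdinary) {Q : ZeroOneMatrix k k} (hQ : Q.IsPermMatrix)
    (h : SymmStep P Q) : Q.IsOrdinary :=
  ⟨hQ, fun R hR => hP.2 R (Relation.ReflTransGen.head h hR)⟩

theorem IsPermMatrix.reverseRows (hP : P.IsPermMatrix) : P.reverseRows.IsPermMatrix := by
  refine ⟨fun i => hP.1 i.rev, fun j => ?_⟩
  obtain ⟨i, hi, hu⟩ := hP.2 j
  refine ⟨i.rev, by simpa [ZeroOneMatrix.reverseRows] using hi, fun i' hi' => ?_⟩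
  rw [← hu _ hi', Fin.rev_rev]

theorem IsPermMatrix.reverseCols (hP : P.IsPermMatrix) : P.reverseCols.IsPermMatrix := by
  refine ⟨fun i => ?_, fun j => hP.2 j.rev⟩
  obtain ⟨j, hj, hu⟩ := hP.1 i
  refine ⟨j.rev, by simpa [ZeroOneMatrix.reverseCols] using hj, fun j' hj' => ?_⟩
  rw [← hu _ hj', Fin.rev_rev]

theorem IsPermMatrix.transpose (hP : P.IsPermMatrix) : IsPermMatrix (k := k) P.transpose :=
  ⟨hP.2, hP.1⟩

theorem IsPermMatrix.rotate (hP : P.IsPermMatrix) : P.rotate.IsPermMatrix :=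
  hP.reverseRows.transpose

theorem IsOrdinary.reverseRows (hP : P.IsOrdinary) : P.reverseRows.IsOrdinary :=
  hP.symmStep hP.1.reverseRows (Or.inl rfl)

theorem IsOrdinary.reverseCols (hP : P.IsOrdinary) : P.reverseCols.IsOrdinary :=
  hP.symmStep hP.1.reverseCols (Or.inr (Or.inl rfl))

theorem IsOrdinary.transpose (hP : P.IsOrdinary) : IsOrdinary (k := k) P.transpose := by
  have h : P.transpose = P.rotate.reverseCols := by
    ext i j
    simp [ZeroOneMatrix.rotate, ZeroOneMatrix.reverseCols, Matrix.transpose]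
  rw [h]
  exact (hP.symmStep hP.1.rotate (Or.inr (Or.inr rfl))).reverseCols

/-! ### Reading Classes 1 to 4 off an embedding into the lattice -/

/-- The indices with `f`-value below a bound form an initial segment. -/
theorem exists_threshold {f : Fin k → ℤ} (hf : StrictMono f) (u : ℤ) :
    ∃ a : ℕ, a ≤ k ∧ ∀ i : Fin k, f i < u ↔ i.val < a := by
  classical
  have hk : ∀ i : Fin k, k ≤ i.val → u ≤ f i := fun i hi => absurd i.isLt (not_lt.2 hi)
  have hex : ∃ m : ℕ, ∀ i : Fin k, m ≤ i.val → u ≤ f i := ⟨k, hk⟩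
  refine ⟨Nat.find hex, Nat.find_min' hex hk, fun i => ⟨fun hi => ?_, fun hi => ?_⟩⟩
  · by_contra hc
    exact absurd (Nat.find_spec hex i (not_lt.1 hc)) (not_le.2 hi)
  · have := Nat.find_min hex hi
    push Not at this
    obtain ⟨i', h1, h2⟩ := this
    exact lt_of_le_of_lt (hf.monotone (Fin.le_def.2 h1)) h2

/-- No index is sent to 0, so those sent to -1 and 1 lie directly on either side of the cut between
negative and positive values. This supplies the adjacency clause of Classes 1 to 3. -/
theorem exists_adjacent {f : Fin k → ℤ} (hf : StrictMono f) (hf0 : ∀ i, f i ≠ 0) :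
    ∃ q : ℕ, ∀ i : Fin k, f i = -1 ∨ f i = 1 → i.val + 1 = q ∨ i.val = q := by
  obtain ⟨q, hqk, hq⟩ := exists_threshold hf 0
  refine ⟨q, fun i hi => ?_⟩
  rcases hi with hi | hi
  · left
    have h1 := (hq i).1 (by omega)
    by_contra hc
    have hlt : i.val + 1 < q := by omega
    have hk : i.val + 1 < k := by omega
    have h2 := (hq ⟨i.val + 1, hk⟩).2 hlt
    have h3 : f i < f ⟨i.val + 1, hk⟩ := hf (Fin.lt_def.2 (by simp))
    omega
  · right
    have h1 : ¬ i.val < q := fun h => by have := (hq i).2 h; omega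
    by_contra hc
    have hlt : q < i.val := by omega
    have h2 := (hq ⟨q, by omega⟩)
    have h3 : f ⟨q, by omega⟩ < f i := hf (Fin.lt_def.2 hlt)
    have h4 := hf0 ⟨q, by omega⟩
    simp only [lt_self_iff_false, iff_false] at h2
    omega

theorem mem_seg {a b : ℕ} {i : Fin k} : i ∈ seg k a b ↔ a ≤ i.val ∧ i.val < b := by
  simp [seg]

theorem mem_onesIn {R C : Finset (Fin k)} {x : Fin k × Fin k} :
    x ∈ onesIn P R C ↔ (x.1 ∈ R ∧ x.2 ∈ C) ∧ P x.1 x.2 = true := by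
  simp [onesIn]

theorem onesIn_seg_nonempty {a b c d : ℕ} {i j : Fin k} (h : P i j = true)
    (ha : a ≤ i.val) (hb : i.val < b) (hc : c ≤ j.val) (hd : j.val < d) :
    (onesIn P (seg k a b) (seg k c d)).Nonempty :=
  ⟨(i, j), by simp [mem_onesIn, mem_seg, *]⟩

theorem onesIn_seg_eq_empty {a b c d : ℕ}
    (h : ∀ i j : Fin k, P i j = true → a ≤ i.val → i.val < b → c ≤ j.val → j.val < d → False) :
    onesIn P (seg k a b) (seg k c d) = ∅ := by
  rw [Finset.eq_empty_iff_forall_notMem]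
  rintro ⟨i, j⟩ hx
  simp only [mem_onesIn, mem_seg] at hx
  exact h i j hx.2 hx.1.1.1 hx.1.1.2 hx.1.2.1 hx.1.2.2

theorem IsPermMatrix.atMostTwoAdjacent (hP : P.IsPermMatrix) {a b c d : ℕ} (q : ℕ)
    (h : ∀ i j : Fin k, P i j = true → a ≤ i.val → i.val < b → c ≤ j.val → j.val < d →
      i.val + 1 = q ∨ i.val = q) :
    AtMostTwoAdjacent (onesIn P (seg k a b) (seg k c d)) := by
  have key : ∀ x ∈ onesIn P (seg k a b) (seg k c d), x.1.val + 1 = q ∨ x.1.val = q := by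
    rintro ⟨i, j⟩ hx
    simp only [mem_onesIn, mem_seg] at hx
    exact h i j hx.2 hx.1.1.1 hx.1.1.2 hx.1.2.1 hx.1.2.2
  have inj : ∀ x ∈ onesIn P (seg k a b) (seg k c d), ∀ y ∈ onesIn P (seg k a b) (seg k c d),
      x.1.val = y.1.val → x = y := by
    rintro ⟨i, j⟩ hx ⟨i', j'⟩ hy hxy
    obtain rfl : i = i' := Fin.ext hxy
    exact Prod.ext rfl (hP.col_inj (mem_onesIn.1 hx).2 (mem_onesIn.1 hy).2)
  constructor
  · calc (onesIn P (seg k a b) (seg k c d)).card ≤ ({q - 1, q} : Finset ℕ).card := by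
          refine Finset.card_le_card_of_injOn (fun x => x.1.val) ?_ ?_
          · intro x hx
            rcases key x hx with h | h <;> simp <;> omega
          · intro x hx y hy hxy
            exact inj x hx y hy hxy
      _ ≤ 2 := Finset.card_le_two
  · intro x hx y hy hxy
    have h1 := key x hx
    have h2 := key y hy
    have h3 : x.1.val ≠ y.1.val := fun h => hxy (inj x hx y hy h)
    omega

/-- Here `f` and `g` are the row and column maps of a copy of `P`. The cuts `u` and `v` in the
target pull back to the splitting of `P`, so the class conditions can be checked on lattice
coordinates. The variants for the other classes follow the same scheme. -/
theorem IsOrdinary.not_class1 (hP : P.IsOrdinary) {f g : Fin k → ℤ} (hf : StrictMono f)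
    (hg : StrictMono g) (hf0 : ∀ i, f i ≠ 0) (u v : ℤ)
    (h11 : ∃ i j, P i j = true ∧ f i < u ∧ g j < v)
    (h22 : ∃ i j, P i j = true ∧ u ≤ f i ∧ v ≤ g j)
    (h21 : ∀ i j, P i j = true → u ≤ f i → v ≤ g j)
    (h12 : ∀ i j, P i j = true → f i < u → v ≤ g j → f i = -1 ∨ f i = 1) : False := by
  obtain ⟨a, -, ha⟩ := exists_threshold hf u
  obtain ⟨c, -, hc⟩ := exists_threshold hg v
  obtain ⟨q, hq⟩ := exists_adjacent hf hf0
  have ha' : ∀ i : Fin k, u ≤ f i ↔ a ≤ i.val := fun i => by rw [← not_lt, ha, not_lt]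
  have hc' : ∀ i : Fin k, v ≤ g i ↔ c ≤ i.val := fun i => by rw [← not_lt, hc, not_lt]
  simp only [ha, hc, ha', hc'] at h11 h22 h21 h12
  obtain ⟨i, j, h1, h2, h3⟩ := h11
  obtain ⟨i', j', h1', h2', h3'⟩ := h22
  refine (hP.2 P .refl).1 ⟨hP.1, a, c, by omega, by omega, by omega, by omega,
    onesIn_seg_nonempty h1 (by omega) (by omega) (by omega) (by omega),
    onesIn_seg_nonempty h1' (by omega) (by omega) (by omega) (by omega),
    onesIn_seg_eq_empty fun i j hij _ _ _ _ => ?_,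
    hP.1.atMostTwoAdjacent q fun i j hij _ _ _ _ => hq i (h12 i j hij (by omega) (by omega))⟩
  have := h21 i j hij (by omega)
  omega

theorem strictMono_neg_rev {f : Fin k → ℤ} (hf : StrictMono f) :
    StrictMono fun i : Fin k => -f i.rev :=
  fun _ _ h => neg_lt_neg (hf (Fin.rev_lt_rev.2 h))

theorem IsOrdinary.not_class1_reverseRows (hP : P.IsOrdinary) {f g : Fin k → ℤ}
    (hf : StrictMono f) (hg : StrictMono g) (hf0 : ∀ i, f i ≠ 0) (u v : ℤ)
    (h21 : ∃ i j, P i j = true ∧ u ≤ f i ∧ g j < v)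
    (h12 : ∃ i j, P i j = true ∧ f i < u ∧ v ≤ g j)
    (h11 : ∀ i j, P i j = true → f i < u → v ≤ g j)
    (h22 : ∀ i j, P i j = true → u ≤ f i → v ≤ g j → f i = -1 ∨ f i = 1) : False := by
  obtain ⟨i, j, h1, h2, h3⟩ := h21
  obtain ⟨i', j', h1', h2', h3'⟩ := h12
  refine hP.reverseRows.not_class1 (strictMono_neg_rev hf) hg (fun i => neg_ne_zero.2 (hf0 _))
    (1 - u) v ⟨i.rev, j, ?_, ?_, h3⟩ ⟨i'.rev, j', ?_, ?_, h3'⟩ (fun i j hij h => ?_)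
    (fun i j hij h h' => ?_)
  · simpa [ZeroOneMatrix.reverseRows] using h1
  · simp only [Fin.rev_rev]; omega
  · simpa [ZeroOneMatrix.reverseRows] using h1'
  · simp only [Fin.rev_rev]; omega
  · exact h11 _ _ hij (by omega)
  · have := h22 _ _ hij (by omega) h'
    omega

theorem IsOrdinary.not_class2 (hP : P.IsOrdinary) {f g : Fin k → ℤ} (hf : StrictMono f)
    (hg : StrictMono g) (hf0 : ∀ i, f i ≠ 0) (u w v : ℤ)
    (h12 : ∃ i j, P i j = true ∧ f i < u ∧ v ≤ g j)
    (h32 : ∃ i j, P i j = true ∧ w ≤ f i ∧ v ≤ g j)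
    (h21 : ∃ i j i' j', P i j = true ∧ P i' j' = true ∧ i ≠ i' ∧ g j < v ∧ g j' < v)
    (h1 : ∀ i j, P i j = true → g j < v → u ≤ f i ∧ f i < w)
    (h22 : ∀ i j, P i j = true → u ≤ f i → f i < w → v ≤ g j → f i = -1 ∨ f i = 1) :
    False := by
  obtain ⟨a, -, ha⟩ := exists_threshold hf u
  obtain ⟨b, -, hb⟩ := exists_threshold hf w
  obtain ⟨c, -, hc⟩ := exists_threshold hg v
  obtain ⟨q, hq⟩ := exists_adjacent hf hf0
  have ha' : ∀ i : Fin k, u ≤ f i ↔ a ≤ i.val := fun i => by rw [← not_lt, ha, not_lt]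
  have hb' : ∀ i : Fin k, w ≤ f i ↔ b ≤ i.val := fun i => by rw [← not_lt, hb, not_lt]
  have hc' : ∀ i : Fin k, v ≤ g i ↔ c ≤ i.val := fun i => by rw [← not_lt, hc, not_lt]
  simp only [ha, hc, ha', hc', hb, hb'] at h12 h32 h21 h1 h22
  obtain ⟨i1, j1, p1, p2, p3⟩ := h12
  obtain ⟨i3, j3, q1, q2, q3⟩ := h32
  obtain ⟨i, j, i', j', r1, r2, r3, r4, r5⟩ := h21
  have s1 := h1 i j r1 r4
  have s2 := h1 i' j' r2 r5
  refine (hP.2 P .refl).2.1 ⟨a, b, c, hP.1, by omega, by omega, by omega, by omega, by omega,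
    onesIn_seg_nonempty p1 (by omega) (by omega) (by omega) (by omega),
    onesIn_seg_nonempty q1 (by omega) (by omega) (by omega) (by omega), ?_,
    onesIn_seg_eq_empty fun i j hij _ _ _ _ => ?_,
    onesIn_seg_eq_empty fun i j hij _ _ _ _ => ?_,
    hP.1.atMostTwoAdjacent q fun i j hij _ _ _ _ =>
      hq i (h22 i j hij (by omega) (by omega) (by omega))⟩
  · refine Finset.one_lt_card.2 ⟨(i, j), ?_, (i', j'), ?_, fun h => r3 (congrArg Prod.fst h)⟩ <;>
      simp only [mem_onesIn, mem_seg] <;> refine ⟨⟨⟨?_, ?_⟩, ?_, ?_⟩, ?_⟩ <;>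
      first | assumption | omega
  · have := h1 i j hij (by omega)
    omega
  · have := h1 i j hij (by omega)
    omega

theorem IsOrdinary.not_class4 (hP : P.IsOrdinary) {f g : Fin k → ℤ} (hf : StrictMono f)
    (hg : StrictMono g) (u w v x : ℤ)
    (h12 : ∃ i j, P i j = true ∧ f i < u ∧ v ≤ g j ∧ g j < x)
    (h21 : ∃ i j, P i j = true ∧ u ≤ f i ∧ f i < w ∧ g j < v)
    (h23 : ∃ i j, P i j = true ∧ u ≤ f i ∧ f i < w ∧ x ≤ g j)
    (h32 : ∃ i j, P i j = true ∧ w ≤ f i ∧ v ≤ g j ∧ g j < x)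
    (h : ∀ i j, P i j = true → (f i < u ∧ v ≤ g j ∧ g j < x) ∨ (w ≤ f i ∧ v ≤ g j ∧ g j < x) ∨
      (u ≤ f i ∧ f i < w ∧ g j < v) ∨ (u ≤ f i ∧ f i < w ∧ x ≤ g j)) : False := by
  obtain ⟨a, -, ha⟩ := exists_threshold hf u
  obtain ⟨b, -, hb⟩ := exists_threshold hf w
  obtain ⟨c, -, hc⟩ := exists_threshold hg v
  obtain ⟨d, -, hd⟩ := exists_threshold hg x
  have ha' : ∀ i : Fin k, u ≤ f i ↔ a ≤ i.val := fun i => by rw [← not_lt, ha, not_lt]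
  have hb' : ∀ i : Fin k, w ≤ f i ↔ b ≤ i.val := fun i => by rw [← not_lt, hb, not_lt]
  have hc' : ∀ i : Fin k, v ≤ g i ↔ c ≤ i.val := fun i => by rw [← not_lt, hc, not_lt]
  have hd' : ∀ i : Fin k, x ≤ g i ↔ d ≤ i.val := fun i => by rw [← not_lt, hd, not_lt]
  simp only [ha, hc, ha', hc', hb, hb', hd, hd'] at h12 h21 h23 h32 h
  obtain ⟨i1, j1, p1, p2, p3, p4⟩ := h12
  obtain ⟨i2, j2, q1, q2, q3, q4⟩ := h21
  obtain ⟨i3, j3, r1, r2, r3, r4⟩ := h23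
  obtain ⟨i4, j4, s1, s2, s3, s4⟩ := h32
  refine (hP.2 P .refl).2.2.2 ⟨hP.1, a, b, c, d, by omega, by omega, by omega, by omega, by omega,
    by omega,
    onesIn_seg_nonempty p1 (by omega) (by omega) (by omega) (by omega),
    onesIn_seg_nonempty q1 (by omega) (by omega) (by omega) (by omega),
    onesIn_seg_nonempty r1 (by omega) (by omega) (by omega) (by omega),
    onesIn_seg_nonempty s1 (by omega) (by omega) (by omega) (by omega),
    onesIn_seg_eq_empty fun i j hij _ _ _ _ => ?_,
    onesIn_seg_eq_empty fun i j hij _ _ _ _ => ?_,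
    onesIn_seg_eq_empty fun i j hij _ _ _ _ => ?_,
    onesIn_seg_eq_empty fun i j hij _ _ _ _ => ?_,
    onesIn_seg_eq_empty fun i j hij _ _ _ _ => ?_⟩ <;>
  · have := h i j hij
    omega

/-- The row of `P` that becomes row `i` when the first row is moved down to position `r`. -/
def frontToRow (r i : Fin k) : Fin k :=
  if h : i.val < r.val then ⟨i.val + 1, by omega⟩ else if i.val = r.val then ⟨0, by omega⟩ else i

theorem frontToRow_of_lt {r i : Fin k} (h : i.val < r.val) : (frontToRow r i).val = i.val + 1 := by
  simp [frontToRow, h]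

theorem frontToRow_self (r : Fin k) : (frontToRow r r).val = 0 := by
  simp [frontToRow]

theorem frontToRow_of_gt {r i : Fin k} (h : r.val < i.val) : frontToRow r i = i := by
  simp [frontToRow, h.ne', h.not_gt]

theorem frontToRow_injective (r : Fin k) : Function.Injective (frontToRow r) := by
  intro i j h
  have h' := congrArg Fin.val h
  simp only [frontToRow] at h'
  split_ifs at h' <;> exact Fin.ext (by first | omega | (simp only at h'; omega))

/-- The matrix obtained by moving the first row down to position `r`. -/
def moveFrontToRow (P : ZeroOneMatrix k k) (r : Fin k) : ZeroOneMatrix k k :=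
  fun i j => P (frontToRow r i) j

theorem moveRowToFront_moveFrontToRow (P : ZeroOneMatrix k k) (r : Fin k) :
    moveRowToFront (moveFrontToRow P r) r = P := by
  funext i j
  unfold moveRowToFront moveFrontToRow
  split_ifs with h1 h2
  · congr 1
    exact Fin.ext ((frontToRow_self r).trans h1.symm)
  · congr 1
    apply Fin.ext
    rw [frontToRow_of_lt (by simp only; omega)]
    simp only
    omega
  · rw [frontToRow_of_gt (by omega)]

theorem IsPermMatrix.moveFrontToRow (hP : P.IsPermMatrix) (r : Fin k) :
    (moveFrontToRow P r).IsPermMatrix := by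
  refine ⟨fun i => hP.1 _, fun j => ?_⟩
  obtain ⟨i, hi, hu⟩ := hP.2 j
  obtain ⟨i', rfl⟩ := Finite.surjective_of_injective (frontToRow_injective r) i
  exact ⟨i', hi, fun y hy => frontToRow_injective r (hu _ hy)⟩

/-- Undo the move of Class 3: push the first row `z` down to the last place above the cut `u` and
count it in the middle block. With the left columns ending at `t`, its one is the rightmost one of
the middle left block, and the result is an element of Class 2. -/
theorem IsOrdinary.not_class3 (hP : P.IsOrdinary) {f : Fin k → ℤ} (hf : StrictMono f)
    (hf0 : ∀ i, f i ≠ 0) (u w : ℤ) (z t : Fin k) (hz : z.val = 0)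
    (hzt : P z t = true) (hzu : f z < u)
    (h12 : ∃ i j, P i j = true ∧ i ≠ z ∧ f i < u)
    (h32 : ∃ i j, P i j = true ∧ w ≤ f i)
    (h21 : ∃ i j, P i j = true ∧ j < t)
    (h1 : ∀ i j, P i j = true → j < t → u ≤ f i ∧ f i < w)
    (h22 : ∀ i j, P i j = true → u ≤ f i → f i < w → t < j → f i = -1 ∨ f i = 1) :
    False := by
  obtain ⟨a, hak, ha⟩ := exists_threshold hf u
  obtain ⟨b, hbk, hb⟩ := exists_threshold hf w
  obtain ⟨q, hq⟩ := exists_adjacent hf hf0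
  have ha' : ∀ i : Fin k, u ≤ f i ↔ a ≤ i.val := fun i => by rw [← not_lt, ha, not_lt]
  have hb' : ∀ i : Fin k, w ≤ f i ↔ b ≤ i.val := fun i => by rw [← not_lt, hb, not_lt]
  simp only [ha, ha', hb, hb', Fin.lt_def] at hzu h12 h32 h21 h1 h22
  obtain ⟨i1, j1, p1, p2, p3⟩ := h12
  obtain ⟨i3, j3, q1, q2⟩ := h32
  obtain ⟨i2, j2, r1, r2⟩ := h21
  have p2' : i1.val ≠ 0 := fun h => p2 (Fin.ext (h.trans hz.symm))
  have hpt : ∀ {i j : Fin k}, P i j = true → i.val ≠ 0 → j.val ≠ t.val := fun hij hi hj => by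
    obtain rfl := Fin.ext hj
    exact hi ((congrArg Fin.val (hP.1.row_inj hij hzt)).trans hz)
  have hr2 := h1 _ _ r1 r2
  have ht1 : t.val < j1.val := by
    have := hpt p1 p2'
    by_contra hc
    have := h1 _ _ p1 (by omega)
    omega
  have ht3 : t.val < j3.val := by
    have := hpt q1 (by omega)
    by_contra hc
    have := h1 _ _ q1 (by omega)
    omega
  -- Position `a - 1` is the last row above the cut; the upper block of the Class 2 element is `[0,
  -- a - 1)`, nonempty thanks to the second row above the cut in `h12`.
  have hX := hP.1.moveFrontToRow ⟨a - 1, by omega⟩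
  set r : Fin k := ⟨a - 1, by omega⟩ with hr
  have hra : r.val = a - 1 := rfl
  have hXt : moveFrontToRow P r r t = true := by
    rw [moveFrontToRow, ← hzt]
    congr 1
    exact Fin.ext ((frontToRow_self r).trans hz.symm)
  have hX1 : moveFrontToRow P r ⟨i1.val - 1, by omega⟩ j1 = true := by
    rw [moveFrontToRow, ← p1]
    congr 1
    apply Fin.ext
    rw [frontToRow_of_lt (by simp only; omega)]
    simp only
    omega
  have hX2 : moveFrontToRow P r i2 j2 = true := by
    rw [moveFrontToRow, frontToRow_of_gt (by omega)]
    exact r1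
  have hX3 : moveFrontToRow P r i3 j3 = true := by
    rw [moveFrontToRow, frontToRow_of_gt (by omega)]
    exact q1
  have hmem : (r, t) ∈ onesIn (moveFrontToRow P r) (seg k (a - 1) b) (seg k 0 (t.val + 1)) := by
    simp only [mem_onesIn, mem_seg]
    exact ⟨⟨by omega, by omega⟩, hXt⟩
  have hout : ∀ i j : Fin k, moveFrontToRow P r i j = true → j.val < t.val + 1 →
      a - 1 ≤ i.val ∧ i.val < b := by
    intro i j hij hj
    by_cases hjt : j = t
    · subst hjt
      obtain rfl := hX.row_inj hij hXt
      omega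
    · have h := h1 _ _ hij (by have := Fin.val_ne_of_ne hjt; omega)
      rcases lt_trichotomy i.val r.val with hi | hi | hi
      · rw [frontToRow_of_lt hi] at h
        omega
      · omega
      · rw [frontToRow_of_gt hi] at h
        omega
  refine (hP.2 P .refl).2.2.1 ⟨moveFrontToRow P r, a - 1, b, t.val + 1, r, t,
    ⟨hX, by omega, by omega, by omega, by omega, by omega,
      onesIn_seg_nonempty hX1 (by omega) (by simp only; omega) (by omega) (by omega),
      onesIn_seg_nonempty hX3 (by omega) (by omega) (by omega) (by omega), ?_,
      onesIn_seg_eq_empty fun i j hij _ _ _ _ => ?_,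
      onesIn_seg_eq_empty fun i j hij _ _ _ _ => ?_,
      hX.atMostTwoAdjacent q fun i j hij _ _ _ _ => hq i ?_⟩, hmem, ?_,
    (moveRowToFront_moveFrontToRow P r).symm⟩
  · refine Finset.one_lt_card.2 ⟨_, hmem, (i2, j2), ?_, fun h => ?_⟩
    · simp only [mem_onesIn, mem_seg]
      exact ⟨⟨by omega, by omega⟩, hX2⟩
    · have := congrArg (fun x => x.2.val) h
      simp only at this
      omega
  · have := hout i j hij (by omega)
    omega
  · have := hout i j hij (by omega)
    omega
  · rcases lt_trichotomy i.val r.val with hi | hi | hi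
    · omega
    · obtain rfl := Fin.ext hi
      have := congrArg Fin.val (hX.col_inj hij hXt)
      omega
    · rw [moveFrontToRow, frontToRow_of_gt hi] at hij
      exact h22 i j hij (by omega) (by omega) (by omega)
  · rintro ⟨i, j⟩ hx
    simp only [mem_onesIn, mem_seg] at hx
    exact Fin.le_def.2 (by simp only; omega)

/-- A one in a corner splits off as a block of its own, which puts `P` or its reflection in Class 1
with both off-diagonal blocks empty. -/
theorem IsOrdinary.row_interior (hP : P.IsOrdinary) (hk : 2 ≤ k) {i j : Fin k}
    (hij : P i j = true) (hj : j.val = 0 ∨ j.val + 1 = k) : 0 < i.val ∧ i.val + 1 < k := by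
  by_contra hc
  -- The shift by 2 makes the row map miss -1, 0 and 1, so the exceptional block has to be empty.
  have hf : StrictMono fun a : Fin k => (a.val : ℤ) + 2 := fun a b h => by
    have := Fin.lt_def.1 h
    simp only
    omega
  have hg : StrictMono fun a : Fin k => (a.val : ℤ) := fun a b h => by
    have := Fin.lt_def.1 h
    simp only
    omega
  have hf0 : ∀ a : Fin k, (a.val : ℤ) + 2 ≠ 0 := fun a => by omega
  have hiff : ∀ i' j' : Fin k, P i' j' = true → (i'.val = i.val ↔ j'.val = j.val) := by
    intro i' j' h
    constructor
    · intro hi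
      obtain rfl := Fin.ext hi
      exact congrArg Fin.val (hP.1.col_inj h hij)
    · intro hj
      obtain rfl := Fin.ext hj
      exact congrArg Fin.val (hP.1.row_inj h hij)
  obtain ⟨i', j', h', hne⟩ : ∃ i' j', P i' j' = true ∧ i'.val ≠ i.val := by
    have : Nontrivial (Fin k) := Fin.nontrivial_iff_two_le.2 hk
    obtain ⟨i', hi'⟩ := exists_ne i
    obtain ⟨j', hj', -⟩ := hP.1.1 i'
    exact ⟨i', j', hj', Fin.val_ne_of_ne hi'⟩
  have hne' := hiff _ _ h'
  have hi : i.val = 0 ∨ i.val + 1 = k := by omega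
  rcases hi with hi | hi <;> rcases hj with hj | hj
  · refine hP.not_class1 hf hg hf0 3 1 ⟨i, j, hij, by omega, by omega⟩
      ⟨i', j', h', by omega, by omega⟩ (fun a b hab h => ?_) (fun a b hab h1 h2 => ?_) <;>
    · have := hiff a b hab
      omega
  · refine hP.not_class1_reverseRows hf hg hf0 3 (k - 1) ⟨i', j', h', by omega, by omega⟩
      ⟨i, j, hij, by omega, by omega⟩ (fun a b hab h => ?_) (fun a b hab h1 h2 => ?_) <;>
    · have := hiff a b hab
      omega
  · refine hP.not_class1_reverseRows hf hg hf0 (k + 1) 1 ⟨i, j, hij, by omega, by omega⟩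
      ⟨i', j', h', by omega, by omega⟩ (fun a b hab h => ?_) (fun a b hab h1 h2 => ?_) <;>
    · have := hiff a b hab
      omega
  · refine hP.not_class1 hf hg hf0 (k + 1) (k - 1) ⟨i', j', h', by omega, by omega⟩
      ⟨i, j, hij, by omega, by omega⟩ (fun a b hab h => ?_) (fun a b hab h1 h2 => ?_) <;>
    · have := hiff a b hab
      omega

/-! ### The arms and their coordinates -/

/-- Leaves `-1`, `0` and `1` in place and moves all other integers outwards by `k`. -/
def spread (k : ℕ) (x : ℤ) : ℤ :=
  if x < -1 then x - k else if 1 < x then x + k else x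

theorem spread_neg (k : ℕ) (x : ℤ) : spread k (-x) = -spread k x := by
  unfold spread
  split_ifs <;> omega

theorem spread_strictMono (k : ℕ) : StrictMono (spread k) := by
  intro x y h
  unfold spread
  split_ifs <;> omega

/-- The left arm: a contiguous copy of `P` without the one in its last column, with row `r` of
`P` in row `0`. -/
def armIn (P : ZeroOneMatrix k k) (r : Fin k) : Set (ℤ × ℤ) :=
  {x | ∃ i j : Fin k, P i j = true ∧ j.val + 1 ≠ k ∧
    x = ((i.val : ℤ) - r.val, (j.val : ℤ) - 3 * k)}

/-- The right arm: a copy of `P` without the one in its first column, with row `l` of `P` in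
row `0`, and the rows not adjacent to it moved outwards. -/
def armOut (P : ZeroOneMatrix k k) (l : Fin k) : Set (ℤ × ℤ) :=
  {x | ∃ i j : Fin k, P i j = true ∧ j.val ≠ 0 ∧
    x = (spread k ((i.val : ℤ) - l.val), (j.val : ℤ) + 2 * k)}

theorem armIn_bounds (hP : P.IsPermMatrix) {r e : Fin k} (he : e.val + 1 = k)
    (hr : P r e = true) {x y : ℤ} (h : (x, y) ∈ armIn P r) :
    -(r.val : ℤ) ≤ x ∧ x ≤ k - 1 - r.val ∧ x ≠ 0 ∧ -(3 * k : ℤ) ≤ y ∧ y ≤ -(2 * k) - 2 := by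
  obtain ⟨i, j, hij, hj, hxy⟩ := h
  obtain ⟨rfl, rfl⟩ := Prod.mk.inj hxy
  refine ⟨by omega, by omega, fun h0 => ?_, by omega, by omega⟩
  obtain rfl : i = r := Fin.ext (by omega)
  have := congrArg Fin.val (hP.col_inj hij hr)
  omega

/-- Rows of the left arm have absolute value below `k`, so apart from rows -1 and 1 the rows of this
arm lie strictly outside them. -/
theorem armOut_bounds (hP : P.IsPermMatrix) {l z : Fin k} (hz : z.val = 0)
    (hl : P l z = true) {x y : ℤ} (h : (x, y) ∈ armOut P l) :
    (x = -1 ∨ x = 1 ∨ (-(2 * k : ℤ) < x ∧ x < -k) ∨ ((k : ℤ) < x ∧ x < 2 * k)) ∧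
      2 * (k : ℤ) + 1 ≤ y ∧ y ≤ 3 * k - 1 := by
  obtain ⟨i, j, hij, hj, hxy⟩ := h
  obtain ⟨rfl, rfl⟩ := Prod.mk.inj hxy
  have hne : i.val ≠ l.val := fun h => by
    obtain rfl := Fin.ext h
    have := congrArg Fin.val (hP.col_inj hij hl)
    omega
  unfold spread
  refine ⟨?_, by omega, by omega⟩
  split_ifs <;> omega

theorem neg_mem_armIn_reverseRows {r : Fin k} {x y : ℤ} (h : (x, y) ∈ armIn P r) :
    (-x, y) ∈ armIn P.reverseRows r.rev := by
  obtain ⟨i, j, hij, hj, hxy⟩ := h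
  obtain ⟨rfl, rfl⟩ := Prod.mk.inj hxy
  refine ⟨i.rev, j, by simpa [ZeroOneMatrix.reverseRows] using hij, hj, ?_⟩
  rw [Fin.val_rev, Fin.val_rev]
  exact Prod.ext (by simp only; omega) rfl

theorem neg_mem_armOut_reverseRows {l : Fin k} {x y : ℤ} (h : (x, y) ∈ armOut P l) :
    (-x, y) ∈ armOut P.reverseRows l.rev := by
  obtain ⟨i, j, hij, hj, hxy⟩ := h
  obtain ⟨rfl, rfl⟩ := Prod.mk.inj hxy
  refine ⟨i.rev, j, by simpa [ZeroOneMatrix.reverseRows] using hij, hj, ?_⟩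
  rw [Fin.val_rev, Fin.val_rev, ← spread_neg]
  exact Prod.ext (congrArg (spread k) (by omega)) rfl

/-! ### Copies of `P` inside the cross -/

theorem strictMono_fin_sub_le {f : Fin k → ℤ} (hf : StrictMono f) {i j : Fin k}
    (h : i.val ≤ j.val) : (j.val : ℤ) - i.val ≤ f j - f i := by
  obtain ⟨d, hd⟩ := Nat.exists_eq_add_of_le h
  induction d generalizing j with
  | zero =>
    obtain rfl : i = j := Fin.ext (by omega)
    simp
  | succ d ih =>
    have h1 := @ih ⟨j.val - 1, by omega⟩ (by simp only; omega) (by simp only; omega)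
    have h2 : f ⟨j.val - 1, by omega⟩ < f j := hf (Fin.lt_def.2 (by simp only; omega))
    simp only at h1
    omega

/-- The copy must place two ones in the left arm, since the right arm alone is too rigid. Cutting at
rows `-k` and `k` then gives Class 2 if right-arm rows occur on both sides, Class 1 up to reflection
if they occur on one side, and a counting contradiction if on neither. -/
theorem IsOrdinary.not_mem_arms (hP : P.IsOrdinary) (hk : 2 ≤ k) {r e l z : Fin k}
    (he : e.val + 1 = k) (hr : P r e = true) (hz : z.val = 0) (hl : P l z = true)
    {f g : Fin k → ℤ} (hf : StrictMono f) (hg : StrictMono g)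
    (h : ∀ i j, P i j = true → (f i, g j) ∈ armIn P r ∨ (f i, g j) ∈ armOut P l) : False := by
  have hri := hP.row_interior hk hr (Or.inr he)
  have hli := hP.row_interior hk hl (Or.inl hz)
  have hA := fun x y => armIn_bounds hP.1 he hr (x := x) (y := y)
  have hB := fun x y => armOut_bounds hP.1 hz hl (x := x) (y := y)
  have hf0 : ∀ i, f i ≠ 0 := fun i => by
    obtain ⟨j, hj, -⟩ := hP.1.1 i
    have := hA (f i) (g j)
    have := hB (f i) (g j)
    rcases h i j hj with h | h <;> simp only [h, true_imp_iff] at * <;> omega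
  have hcols : ∃ i j i' j', P i j = true ∧ P i' j' = true ∧ i ≠ i' ∧ g j < 0 ∧ g j' < 0 := by
    by_contra hc
    have hg1 : ∀ j : Fin k, j.val ≠ 0 → (2 * k + 1 : ℤ) ≤ g j ∧ g j ≤ 3 * k - 1 := by
      intro j hj
      obtain ⟨i, hi, -⟩ := hP.1.2 j
      rcases h i j hi with h1 | h1
      · exfalso
        have h2 := hA _ _ h1
        have h3 : g z < g j := hg (Fin.lt_def.2 (by omega))
        refine hc ⟨i, j, l, z, hi, hl, ?_, by omega, by omega⟩
        rintro rfl
        exact hj (by rw [hP.1.col_inj hi hl, hz])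
      · have := hB _ _ h1
        omega
    -- The right arm has exactly `k - 1` columns, so the `k - 1` columns of `P` after the first fill
    -- them in order.
    have hgj : ∀ j : Fin k, j.val ≠ 0 → g j = j.val + 2 * k := by
      intro j hj
      have h1 := strictMono_fin_sub_le hg (i := ⟨1, by omega⟩) (j := j) (by simp only; omega)
      have h2 := strictMono_fin_sub_le hg (i := j) (j := e) (by omega)
      have h3 := hg1 ⟨1, by omega⟩ (by simp)
      have h4 := hg1 e (by omega)
      simp only at h1
      omega
    have hfi : ∀ i : Fin k, i.val ≠ l.val → f i = spread k ((i.val : ℤ) - l.val) := by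
      intro i hi
      obtain ⟨j, hj, -⟩ := hP.1.1 i
      have hj0 : j.val ≠ 0 := fun h0 => by
        obtain rfl : j = z := Fin.ext (h0.trans hz.symm)
        exact hi (congrArg Fin.val (hP.1.row_inj hj hl))
      have hgj' := hgj j hj0
      rcases h i j hj with h1 | ⟨i', j', h1, h2, h3⟩
      · have := hA _ _ h1
        omega
      · obtain ⟨h4, h5⟩ := Prod.mk.inj h3
        obtain rfl : j = j' := Fin.ext (by omega)
        rw [h4, hP.1.row_inj h1 hj]
    -- Rows `l - 1` and `l + 1`, which exist by `row_interior`, are sent to -1 and 1; row `l` is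
    -- squeezed onto the forbidden value 0.
    have h1 := hfi ⟨l.val - 1, by omega⟩ (by simp only; omega)
    have h2 := hfi ⟨l.val + 1, by omega⟩ (by simp)
    have h3 : f ⟨l.val - 1, by omega⟩ < f l := hf (Fin.lt_def.2 (by simp only; omega))
    have h4 : f l < f ⟨l.val + 1, by omega⟩ := hf (Fin.lt_def.2 (by simp))
    have h5 := hf0 l
    unfold spread at h1 h2
    simp only at h1 h2
    split_ifs at h1 h2 <;> omega
  obtain ⟨ia, ja, ib, jb, ha, hb, hab, hga, hgb⟩ := hcols
  have haA : (f ia, g ja) ∈ armIn P r := (h _ _ ha).resolve_right fun h' => by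
    have := hB _ _ h'
    omega
  have ha' := hA _ _ haA
  by_cases hT : ∃ i j, P i j = true ∧ f i < -k
  · by_cases hBt : ∃ i j, P i j = true ∧ (k : ℤ) ≤ f i
    · obtain ⟨i1, j1, p1, p2⟩ := hT
      obtain ⟨i2, j2, q1, q2⟩ := hBt
      refine hP.not_class2 hf hg hf0 (-k) k 0 ⟨i1, j1, p1, p2, ?_⟩ ⟨i2, j2, q1, q2, ?_⟩
        ⟨ia, ja, ib, jb, ha, hb, hab, hga, hgb⟩ (fun i j hij h1 => ?_)
        (fun i j hij h1 h2 h3 => ?_)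
      · rcases h _ _ p1 with h' | h' <;> [have := hA _ _ h'; have := hB _ _ h'] <;> omega
      · rcases h _ _ q1 with h' | h' <;> [have := hA _ _ h'; have := hB _ _ h'] <;> omega
      · rcases h _ _ hij with h' | h' <;> [have := hA _ _ h'; have := hB _ _ h'] <;> omega
      · rcases h _ _ hij with h' | h' <;> [have := hA _ _ h'; have := hB _ _ h'] <;> omega
    · push Not at hBt
      obtain ⟨i1, j1, p1, p2⟩ := hT
      refine hP.not_class1_reverseRows hf hg hf0 (-k) 0 ⟨ia, ja, ha, by omega, hga⟩
        ⟨i1, j1, p1, p2, ?_⟩ (fun i j hij h1 => ?_) (fun i j hij h1 h2 => ?_)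
      · rcases h _ _ p1 with h' | h' <;> [have := hA _ _ h'; have := hB _ _ h'] <;> omega
      · rcases h _ _ hij with h' | h' <;> [have := hA _ _ h'; have := hB _ _ h'] <;> omega
      · have := hBt _ _ hij
        rcases h _ _ hij with h' | h' <;> [have := hA _ _ h'; have := hB _ _ h'] <;> omega
  · push Not at hT
    by_cases hBt : ∃ i j, P i j = true ∧ (k : ℤ) ≤ f i
    · obtain ⟨i2, j2, q1, q2⟩ := hBt
      refine hP.not_class1 hf hg hf0 k 0 ⟨ia, ja, ha, by omega, hga⟩
        ⟨i2, j2, q1, q2, ?_⟩ (fun i j hij h1 => ?_) (fun i j hij h1 h2 => ?_)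
      · rcases h _ _ q1 with h' | h' <;> [have := hA _ _ h'; have := hB _ _ h'] <;> omega
      · rcases h _ _ hij with h' | h' <;> [have := hA _ _ h'; have := hB _ _ h'] <;> omega
      · have := hT _ _ hij
        rcases h _ _ hij with h' | h' <;> [have := hA _ _ h'; have := hB _ _ h'] <;> omega
    · push Not at hBt
      -- All `k` rows of `P` now lie among the `k` consecutive rows spanned by the left arm, so row
      -- `r` must be sent to 0.
      have hrange : ∀ i, -(r.val : ℤ) ≤ f i ∧ f i ≤ k - 1 - r.val := by
        intro i
        obtain ⟨j, hj, -⟩ := hP.1.1 i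
        have h1 := hT _ _ hj
        have h2 := hBt _ _ hj
        rcases h _ _ hj with h' | h' <;> [have := hA _ _ h'; have := hB _ _ h'] <;> omega
      have h1 := hrange z
      have h2 := hrange e
      have h3 := strictMono_fin_sub_le hf (i := z) (j := r) (by omega)
      have h4 := strictMono_fin_sub_le hf (i := r) (j := e) (by omega)
      exact hf0 r (by omega)

/-- Two ones in the top arm give Class 2 for the transpose, with an empty exceptional block. A
single one there lies in the first row of `P`; the rest is a copy in the left and right arms,
treated by the cuts at `-k` and `k` as before, with Class 3 replacing Class 2. -/
theorem IsOrdinary.not_mem_arms_or_top (hP : P.IsOrdinary) {r e l z : Fin k}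
    (he : e.val + 1 = k) (hr : P r e = true) (hz : z.val = 0) (hl : P l z = true)
    {f g : Fin k → ℤ} (hf : StrictMono f) (hg : StrictMono g)
    (h : ∀ i j, P i j = true → (f i, g j) ∈ armIn P r ∨ (f i, g j) ∈ armOut P l ∨
      (f i < -(2 * k) ∧ -(2 * k) ≤ g j ∧ g j ≤ 2 * k ∧ g j ≠ 0))
    (hW : ∃ i j, P i j = true ∧ (f i, g j) ∈ armIn P r)
    (hE : ∃ i j, P i j = true ∧ (f i, g j) ∈ armOut P l)
    (hN : ∃ i j, P i j = true ∧ f i < -(2 * k)) : False := by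
  have hA := fun x y => armIn_bounds hP.1 he hr (x := x) (y := y)
  have hB := fun x y => armOut_bounds hP.1 hz hl (x := x) (y := y)
  have hf0 : ∀ i, f i ≠ 0 := fun i => by
    obtain ⟨j, hj, -⟩ := hP.1.1 i
    rcases h i j hj with h' | h' | h' <;>
      [have := hA _ _ h'; have := hB _ _ h'; have := h'] <;> omega
  have hg0 : ∀ j, g j ≠ 0 := fun j => by
    obtain ⟨i, hi, -⟩ := hP.1.2 j
    rcases h i j hi with h' | h' | h' <;>
      [have := hA _ _ h'; have := hB _ _ h'; have := h'] <;> omega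
  obtain ⟨ia, ja, ha, haA⟩ := hW
  obtain ⟨ib, jb, hb, hbB⟩ := hE
  obtain ⟨i0, j0, h0, hi0⟩ := hN
  have ha' := hA _ _ haA
  have hb' := hB _ _ hbB
  obtain ⟨t, hzt, -⟩ := hP.1.1 z
  have hfz : f z < -(2 * k) := lt_of_le_of_lt (hf.monotone (Fin.le_def.2 (by omega))) hi0
  by_cases hN2 : ∃ i j, P i j = true ∧ i ≠ z ∧ f i < -(2 * k)
  · obtain ⟨i1, j1, p1, p2, p3⟩ := hN2
    refine hP.transpose.not_class2 hg hf hg0 (-(2 * k)) (2 * k + 1) (-(2 * k))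
      ⟨ja, ia, ha, by omega, by omega⟩ ⟨jb, ib, hb, by omega, by omega⟩
      ⟨t, z, j1, i1, hzt, p1, ?_, hfz, p3⟩ (fun i j hij h1 => ?_) (fun i j hij h1 h2 h3 => ?_)
    · rintro rfl
      exact p2 (hP.1.row_inj p1 hzt)
    · rcases h _ _ hij with h' | h' | h' <;>
        [have := hA _ _ h'; have := hB _ _ h'; have := h'] <;> omega
    · rcases h _ _ hij with h' | h' | h' <;>
        [have := hA _ _ h'; have := hB _ _ h'; have := h'] <;> omega
  push Not at hN2
  have ht : -(2 * k) ≤ g t ∧ g t ≤ 2 * k := by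
    rcases h _ _ hzt with h' | h' | h' <;>
      [have := hA _ _ h'; have := hB _ _ h'; have := h'] <;> omega
  have harm : ∀ i j, P i j = true → i ≠ z →
      (f i, g j) ∈ armIn P r ∨ (f i, g j) ∈ armOut P l := by
    intro i j hij hi
    have := hN2 i j hij hi
    rcases h _ _ hij with h' | h' | h'
    · exact Or.inl h'
    · exact Or.inr h'
    · omega
  have hne : ∀ i j, P i j = true → i = z → g j = g t := by
    rintro i j hij rfl
    rw [hP.1.col_inj hij hzt]
  by_cases hBt : ∃ i j, P i j = true ∧ (k : ℤ) ≤ f i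
  · obtain ⟨i2, j2, q1, q2⟩ := hBt
    by_cases hT : ∃ i j, P i j = true ∧ i ≠ z ∧ f i < -k
    · refine hP.not_class3 hf hf0 (-k) k z t hz hzt (by omega) hT ⟨i2, j2, q1, q2⟩
        ⟨ia, ja, ha, hg.lt_iff_lt.1 (by omega)⟩ (fun i j hij h1 => ?_)
        (fun i j hij h1 h2 h3 => ?_)
      · have h1' := hg h1
        have hi : i ≠ z := fun hi => by have := hne _ _ hij hi; omega
        rcases harm _ _ hij hi with h' | h' <;> [have := hA _ _ h'; have := hB _ _ h'] <;> omega
      · have h3' := hg h3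
        have hi : i ≠ z := fun hi => by have := hne _ _ hij hi; omega
        rcases harm _ _ hij hi with h' | h' <;> [have := hA _ _ h'; have := hB _ _ h'] <;> omega
    · push Not at hT
      have hi2 : i2 ≠ z := by
        rintro rfl
        omega
      refine hP.not_class1 hf hg hf0 k (2 * k + 1) ⟨z, t, hzt, by omega, by omega⟩
        ⟨i2, j2, q1, q2, ?_⟩ (fun i j hij h1 => ?_) (fun i j hij h1 h2 => ?_)
      · rcases harm _ _ q1 hi2 with h' | h' <;> [have := hA _ _ h'; have := hB _ _ h'] <;> omega
      · have hi : i ≠ z := by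
          rintro rfl
          omega
        rcases harm _ _ hij hi with h' | h' <;> [have := hA _ _ h'; have := hB _ _ h'] <;> omega
      · have hi : i ≠ z := fun hi => by have := hne _ _ hij hi; omega
        have := hT _ _ hij hi
        rcases harm _ _ hij hi with h' | h' <;> [have := hA _ _ h'; have := hB _ _ h'] <;> omega
  · push Not at hBt
    refine hP.not_class1_reverseRows hf hg hf0 (-k) (-(2 * k)) ⟨ia, ja, ha, by omega, by omega⟩
      ⟨z, t, hzt, by omega, by omega⟩ (fun i j hij h1 => ?_) (fun i j hij h1 h2 => ?_)
    · by_cases hi : i = z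
      · have := hne _ _ hij hi
        omega
      · rcases harm _ _ hij hi with h' | h' <;> [have := hA _ _ h'; have := hB _ _ h'] <;> omega
    · have hi : i ≠ z := by
        rintro rfl
        omega
      have := hBt _ _ hij
      rcases harm _ _ hij hi with h' | h' <;> [have := hA _ _ h'; have := hB _ _ h'] <;> omega

theorem IsOrdinary.not_mem_arms_or_bottom (hP : P.IsOrdinary) {r e l z : Fin k}
    (he : e.val + 1 = k) (hr : P r e = true) (hz : z.val = 0) (hl : P l z = true)
    {f g : Fin k → ℤ} (hf : StrictMono f) (hg : StrictMono g)
    (h : ∀ i j, P i j = true → (f i, g j) ∈ armIn P r ∨ (f i, g j) ∈ armOut P l ∨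
      (2 * k < f i ∧ -(2 * k) ≤ g j ∧ g j ≤ 2 * k ∧ g j ≠ 0))
    (hW : ∃ i j, P i j = true ∧ (f i, g j) ∈ armIn P r)
    (hE : ∃ i j, P i j = true ∧ (f i, g j) ∈ armOut P l)
    (hS : ∃ i j, P i j = true ∧ 2 * k < f i) : False := by
  have hrev : ∀ {i j : Fin k}, P i j = true → P.reverseRows i.rev j = true := fun h => by
    simpa [ZeroOneMatrix.reverseRows] using h
  obtain ⟨ia, ja, ha, haA⟩ := hW
  obtain ⟨ib, jb, hb, hbB⟩ := hE
  obtain ⟨i0, j0, h0, hi0⟩ := hS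
  refine hP.reverseRows.not_mem_arms_or_top he (hrev hr) hz (hrev hl) (strictMono_neg_rev hf) hg
    (fun i j hij => ?_) ⟨ia.rev, ja, hrev ha, ?_⟩ ⟨ib.rev, jb, hrev hb, ?_⟩
    ⟨i0.rev, j0, hrev h0, ?_⟩
  · rcases h _ _ hij with h' | h' | h'
    · exact Or.inl (neg_mem_armIn_reverseRows h')
    · exact Or.inr (Or.inl (neg_mem_armOut_reverseRows h'))
    · exact Or.inr (Or.inr (by omega))
  · simp only [Fin.rev_rev]
    exact neg_mem_armIn_reverseRows haA
  · simp only [Fin.rev_rev]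
    exact neg_mem_armOut_reverseRows hbB
  · simp only [Fin.rev_rev]
    omega

/-! ### The cross avoids `P` -/

/-- The four arms of the cross. -/
def crossSet (P : ZeroOneMatrix k k) (r l b t : Fin k) : Set (ℤ × ℤ) :=
  {x | x ∈ armIn P r ∨ x ∈ armOut P l ∨ x.swap ∈ armIn (k := k) P.transpose b ∨
    x.swap ∈ armOut (k := k) P.transpose t}

theorem swap_mem_crossSet_transpose {r l b t : Fin k} {x y : ℤ}
    (h : (x, y) ∈ crossSet P r l b t) :
    (y, x) ∈ crossSet (k := k) P.transpose b t r l := by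
  rcases h with h | h | h | h
  exacts [Or.inr (Or.inr (Or.inl h)), Or.inr (Or.inr (Or.inr h)), Or.inl h, Or.inr (Or.inl h)]

theorem IsOrdinary.not_mem_left_right (hP : P.IsOrdinary) {r e l z b t : Fin k}
    (he : e.val + 1 = k) (hr : P r e = true) (hz : z.val = 0) (hl : P l z = true)
    (hb : P e b = true) (ht : P z t = true)
    {f g : Fin k → ℤ} (hf : StrictMono f) (hg : StrictMono g)
    (h : ∀ i j, P i j = true → (f i, g j) ∈ crossSet P r l b t)
    (hW : ∃ i j, P i j = true ∧ (f i, g j) ∈ armIn P r)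
    (hE : ∃ i j, P i j = true ∧ (f i, g j) ∈ armOut P l)
    (hNS : ∃ i j, P i j = true ∧ (f i < -(2 * k) ∨ 2 * k < f i)) : False := by
  have hA := fun x y => armIn_bounds hP.1 he hr (x := x) (y := y)
  have hB := fun x y => armOut_bounds hP.1 hz hl (x := x) (y := y)
  have hC := fun x y => armIn_bounds hP.1.transpose he hb (x := x) (y := y)
  have hD := fun x y => armOut_bounds hP.1.transpose hz ht (x := x) (y := y)
  by_cases hN : ∃ i j, P i j = true ∧ f i < -(2 * k)
  · by_cases hS : ∃ i j, P i j = true ∧ 2 * k < f i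
    · obtain ⟨ia, ja, ha, haA⟩ := hW
      obtain ⟨ib, jb, hb, hbB⟩ := hE
      obtain ⟨ic, jc, hc, hcC⟩ := hN
      obtain ⟨id, jd, hd, hdD⟩ := hS
      have := hA _ _ haA
      have := hB _ _ hbB
      refine hP.not_class4 hf hg (-(2 * k)) (2 * k + 1) (-(2 * k)) (2 * k + 1)
        ⟨ic, jc, hc, by omega, ?_⟩ ⟨ia, ja, ha, by omega, by omega, by omega⟩
        ⟨ib, jb, hb, by omega, by omega, by omega⟩ ⟨id, jd, hd, by omega, ?_⟩
        (fun i j hij => ?_)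
      · rcases h _ _ hc with h' | h' | h' | h' <;>
          [have := hA _ _ h'; have := hB _ _ h'; have := hC _ _ h'; have := hD _ _ h'] <;> omega
      · rcases h _ _ hd with h' | h' | h' | h' <;>
          [have := hA _ _ h'; have := hB _ _ h'; have := hC _ _ h'; have := hD _ _ h'] <;> omega
      · rcases h _ _ hij with h' | h' | h' | h' <;>
          [have := hA _ _ h'; have := hB _ _ h'; have := hC _ _ h'; have := hD _ _ h'] <;> omega
    · push Not at hS
      refine hP.not_mem_arms_or_top he hr hz hl hf hg (fun i j hij => ?_) hW hE hN
      have := hS _ _ hij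
      rcases h _ _ hij with h' | h' | h' | h'
      · exact Or.inl h'
      · exact Or.inr (Or.inl h')
      · have := hC _ _ h'
        exact Or.inr (Or.inr (by omega))
      · have := hD _ _ h'
        omega
  · push Not at hN
    refine hP.not_mem_arms_or_bottom he hr hz hl hf hg (fun i j hij => ?_) hW hE ?_
    · have := hN _ _ hij
      rcases h _ _ hij with h' | h' | h' | h'
      · exact Or.inl h'
      · exact Or.inr (Or.inl h')
      · have := hC _ _ h'
        omega
      · have := hD _ _ h'
        exact Or.inr (Or.inr (by omega))
    · obtain ⟨i, j, hij, h'⟩ := hNS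
      have := hN _ _ hij
      exact ⟨i, j, hij, by omega⟩

/-- `P` occurs in the set `S` of lattice points. -/
def OccursIn {k : ℕ} (P : ZeroOneMatrix k k) (S : Set (ℤ × ℤ)) : Prop :=
  ∃ f g : Fin k → ℤ, StrictMono f ∧ StrictMono g ∧ ∀ i j, P i j = true → (f i, g j) ∈ S

/-- Coordinates beyond `2k` in absolute value tell the arms apart: vertical arms exceed it in the
row, horizontal ones in the column. Once copies in only two opposite arms and in three or four arms
are excluded, one vertical and one horizontal arm remain, a block decomposition in Class 1 or its
reflection. -/
theorem IsOrdinary.not_occursIn_crossSet (hP : P.IsOrdinary) (hk : 2 ≤ k) {r e l z b t : Fin k}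
    (he : e.val + 1 = k) (hr : P r e = true) (hz : z.val = 0) (hl : P l z = true)
    (hb : P e b = true) (ht : P z t = true) : ¬ OccursIn P (crossSet P r l b t) := by
  rintro ⟨f, g, hf, hg, h⟩
  have hA := fun x y => armIn_bounds hP.1 he hr (x := x) (y := y)
  have hB := fun x y => armOut_bounds hP.1 hz hl (x := x) (y := y)
  have hC := fun x y => armIn_bounds hP.1.transpose he hb (x := x) (y := y)
  have hD := fun x y => armOut_bounds hP.1.transpose hz ht (x := x) (y := y)
  have hf0 : ∀ i, f i ≠ 0 := fun i => by
    obtain ⟨j, hj, -⟩ := hP.1.1 i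
    rcases h _ _ hj with h' | h' | h' | h' <;>
      [have := hA _ _ h'; have := hB _ _ h'; have := hC _ _ h'; have := hD _ _ h'] <;> omega
  by_cases hV : ∃ i j, P i j = true ∧ (f i < -(2 * k) ∨ 2 * k < f i)
  swap
  · push Not at hV
    refine hP.not_mem_arms hk he hr hz hl hf hg fun i j hij => ?_
    have := hV _ _ hij
    rcases h _ _ hij with h' | h' | h' | h'
    · exact Or.inl h'
    · exact Or.inr h'
    · have := hC _ _ h'
      omega
    · have := hD _ _ h'
      omega
  by_cases hH : ∃ i j, P i j = true ∧ (g j < -(2 * k) ∨ 2 * k < g j)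
  swap
  · push Not at hH
    refine hP.transpose.not_mem_arms hk he hb hz ht hg hf fun j i hij => ?_
    have := hH _ _ hij
    rcases h _ _ hij with h' | h' | h' | h'
    · have := hA _ _ h'
      omega
    · have := hB _ _ h'
      omega
    · exact Or.inl h'
    · exact Or.inr h'
  have hWE : ¬ ((∃ i j, P i j = true ∧ (f i, g j) ∈ armIn P r) ∧
      ∃ i j, P i j = true ∧ (f i, g j) ∈ armOut P l) := fun hc =>
    hP.not_mem_left_right he hr hz hl hb ht hf hg h hc.1 hc.2 hV
  have hNS : ¬ ((∃ i j, P i j = true ∧ (g j, f i) ∈ armIn (k := k) P.transpose b) ∧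
      ∃ i j, P i j = true ∧ (g j, f i) ∈ armOut (k := k) P.transpose t) := by
    rintro ⟨⟨i, j, hij, h1⟩, i', j', hij', h2⟩
    obtain ⟨i0, j0, h0, h0'⟩ := hH
    exact hP.transpose.not_mem_left_right he hb hz ht hr hl hg hf
      (fun j i hij => swap_mem_crossSet_transpose (h i j hij)) ⟨j, i, hij, h1⟩
      ⟨j', i', hij', h2⟩ ⟨j0, i0, h0, h0'⟩
  obtain ⟨i1, j1, p1, p2⟩ := hV
  obtain ⟨i2, j2, q1, q2⟩ := hH
  rcases h _ _ p1 with h1 | h1 | h1 | h1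
  · have := hA _ _ h1
    omega
  · have := hB _ _ h1
    omega
  · have hS : ∀ i j, P i j = true → (g j, f i) ∉ armOut (k := k) P.transpose t :=
      fun i j hij h' => hNS ⟨⟨i1, j1, p1, h1⟩, i, j, hij, h'⟩
    have hi1 := hC _ _ h1
    rcases h _ _ q1 with h2 | h2 | h2 | h2
    · have hi2 := hA _ _ h2
      have hE : ∀ i j, P i j = true → (f i, g j) ∉ armOut P l :=
        fun i j hij h' => hWE ⟨⟨i2, j2, q1, h2⟩, i, j, hij, h'⟩
      refine hP.not_class1_reverseRows hf hg hf0 (-(2 * k)) (-(2 * k))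
        ⟨i2, j2, q1, by omega, by omega⟩ ⟨i1, j1, p1, by omega, by omega⟩
        (fun i j hij h3 => ?_) (fun i j hij h3 h4 => ?_) <;>
      · rcases h _ _ hij with h' | h' | h' | h' <;>
        [have := hA _ _ h'; exact (hE _ _ hij h').elim; have := hC _ _ h';
          exact (hS _ _ hij h').elim] <;> omega
    · have hi2 := hB _ _ h2
      have hW : ∀ i j, P i j = true → (f i, g j) ∉ armIn P r :=
        fun i j hij h' => hWE ⟨⟨i, j, hij, h'⟩, i2, j2, q1, h2⟩
      refine hP.not_class1 hf hg hf0 (-(2 * k)) (2 * k + 1)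
        ⟨i1, j1, p1, by omega, by omega⟩ ⟨i2, j2, q1, by omega, by omega⟩
        (fun i j hij h3 => ?_) (fun i j hij h3 h4 => ?_) <;>
      · rcases h _ _ hij with h' | h' | h' | h' <;>
        [exact (hW _ _ hij h').elim; have := hB _ _ h'; have := hC _ _ h';
          exact (hS _ _ hij h').elim] <;> omega
    · have := hC _ _ h2
      omega
    · exact hS _ _ q1 h2
  · have hN : ∀ i j, P i j = true → (g j, f i) ∉ armIn (k := k) P.transpose b :=
      fun i j hij h' => hNS ⟨⟨i, j, hij, h'⟩, i1, j1, p1, h1⟩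
    have hi1 := hD _ _ h1
    rcases h _ _ q1 with h2 | h2 | h2 | h2
    · have hi2 := hA _ _ h2
      have hE : ∀ i j, P i j = true → (f i, g j) ∉ armOut P l :=
        fun i j hij h' => hWE ⟨⟨i2, j2, q1, h2⟩, i, j, hij, h'⟩
      refine hP.not_class1 hf hg hf0 (2 * k + 1) (-(2 * k))
        ⟨i2, j2, q1, by omega, by omega⟩ ⟨i1, j1, p1, by omega, by omega⟩
        (fun i j hij h3 => ?_) (fun i j hij h3 h4 => ?_) <;>
      · rcases h _ _ hij with h' | h' | h' | h' <;>
        [have := hA _ _ h'; exact (hE _ _ hij h').elim; exact (hN _ _ hij h').elim;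
          have := hD _ _ h'] <;> omega
    · have hi2 := hB _ _ h2
      have hW : ∀ i j, P i j = true → (f i, g j) ∉ armIn P r :=
        fun i j hij h' => hWE ⟨⟨i, j, hij, h'⟩, i2, j2, q1, h2⟩
      refine hP.not_class1_reverseRows hf hg hf0 (2 * k + 1) (2 * k + 1)
        ⟨i1, j1, p1, by omega, by omega⟩ ⟨i2, j2, q1, by omega, by omega⟩
        (fun i j hij h3 => ?_) (fun i j hij h3 h4 => ?_) <;>
      · rcases h _ _ hij with h' | h' | h' | h' <;>
        [exact (hW _ _ hij h').elim; have := hB _ _ h'; exact (hN _ _ hij h').elim;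
          have := hD _ _ h'] <;> omega
    · exact hN _ _ q1 h2
    · have := hD _ _ h2
      omega

/-! ### New ones in the central row or column -/

/-- An occurrence of `P` in `S` inside the box `[-w, w] × [-w, w]`. -/
def OccursInBox {k : ℕ} (P : ZeroOneMatrix k k) (w : ℕ) (S : Set (ℤ × ℤ)) : Prop :=
  ∃ f g : Fin k → ℤ, StrictMono f ∧ StrictMono g ∧ (∀ i, -(w : ℤ) ≤ f i ∧ f i ≤ w) ∧
    (∀ j, -(w : ℤ) ≤ g j ∧ g j ≤ w) ∧ ∀ i j, P i j = true → (f i, g j) ∈ S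

theorem OccursInBox.transpose {w : ℕ} {S T : Set (ℤ × ℤ)}
    (h : OccursInBox (k := k) P.transpose w S) (hST : ∀ x ∈ S, x.swap ∈ T) :
    OccursInBox P w T := by
  obtain ⟨f, g, hf, hg, hfw, hgw, h⟩ := h
  exact ⟨g, f, hg, hf, hgw, hfw, fun i j hij => hST _ (h j i hij)⟩

theorem occursInBox_insert_row (hP : P.IsPermMatrix) {r e l z b t : Fin k}
    (he : e.val + 1 = k) (hr : P r e = true) (hz : z.val = 0) (hl : P l z = true) {y : ℤ}
    (hy : -((3 * k : ℕ) : ℤ) ≤ y ∧ y ≤ (3 * k : ℕ)) :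
    OccursInBox P (3 * k) (insert (0, y) (crossSet P r l b t)) := by
  -- A new one with `y ≥ 0` is right of the left arm and serves as its missing last column; one with
  -- `y < 0` is left of the right arm and serves as its missing first column.
  by_cases hy0 : 0 ≤ y
  · refine ⟨fun i => (i.val : ℤ) - r.val, fun j => if j.val + 1 = k then y else j.val - 3 * k,
      fun i i' h => ?_, fun j j' h => ?_, fun i => ?_, fun j => ?_, fun i j hij => ?_⟩
    · have := Fin.lt_def.1 h
      simp only
      omega
    · have := Fin.lt_def.1 h
      simp only
      split_ifs <;> omega
    · simp only
      omega
    · simp only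
      split_ifs <;> omega
    · simp only
      split_ifs with hj
      · left
        obtain rfl : j = e := Fin.ext (by omega)
        rw [hP.row_inj hij hr, sub_self]
      · exact Or.inr (Or.inl ⟨i, j, hij, hj, rfl⟩)
  · refine ⟨fun i => spread k ((i.val : ℤ) - l.val),
      fun j => if j.val = 0 then y else j.val + 2 * k,
      fun i i' h => spread_strictMono k ?_, fun j j' h => ?_, fun i => ?_, fun j => ?_,
      fun i j hij => ?_⟩
    · have := Fin.lt_def.1 h
      omega
    · have := Fin.lt_def.1 h
      simp only
      split_ifs <;> omega
    · simp only [spread]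
      split_ifs <;> omega
    · simp only
      split_ifs <;> omega
    · simp only
      split_ifs with hj
      · left
        obtain rfl : j = z := Fin.ext (by omega)
        rw [hP.row_inj hij hl, sub_self]
        simp [spread]
      · exact Or.inr (Or.inr (Or.inl ⟨i, j, hij, hj, rfl⟩))

theorem occursInBox_insert_col (hP : P.IsPermMatrix) {r e l z b t : Fin k}
    (he : e.val + 1 = k) (hz : z.val = 0) (hb : P e b = true) (ht : P z t = true) {x : ℤ}
    (hx : -((3 * k : ℕ) : ℤ) ≤ x ∧ x ≤ (3 * k : ℕ)) :
    OccursInBox P (3 * k) (insert (x, 0) (crossSet P r l b t)) := by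
  refine (occursInBox_insert_row hP.transpose he hb hz ht (b := r) (t := l) hx).transpose ?_
  rintro ⟨a, c⟩ (h | h)
  · exact Or.inl (congrArg Prod.swap h)
  · exact Or.inr (swap_mem_crossSet_transpose h)

/-! ### From the lattice to `n × n` matrices -/

/-- Collapses the middle indices to `0` and numbers the first `w` and last `w` indices
`-w, …, -1` and `1, …, w`. -/
def collapse (n w : ℕ) (a : Fin n) : ℤ :=
  if a.val < w then (a.val : ℤ) - w else if a.val + w < n then 0 else (a.val : ℤ) - n + w + 1

variable {n w : ℕ}

theorem collapse_monotone (n w : ℕ) : Monotone (collapse n w) := by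
  intro a b hab
  have := Fin.le_def.1 hab
  unfold collapse
  split_ifs <;> omega

theorem collapse_bounds (a : Fin n) :
    -(w : ℤ) ≤ collapse n w a ∧ collapse n w a ≤ w := by
  unfold collapse
  split_ifs <;> omega

theorem collapse_injOn {a b : Fin n} (ha : collapse n w a ≠ 0)
    (hab : collapse n w a = collapse n w b) : a = b := by
  apply Fin.ext
  unfold collapse at ha hab
  split_ifs at ha hab <;> omega

theorem exists_collapse_eq (h : 2 * w < n) {x : ℤ} (hx : -(w : ℤ) ≤ x ∧ x ≤ w) :
    ∃ a, collapse n w a = x := by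
  rcases lt_trichotomy x 0 with h0 | h0 | h0
  · refine ⟨⟨(x + w).toNat, by omega⟩, ?_⟩
    unfold collapse
    split_ifs <;> simp only at * <;> omega
  · refine ⟨⟨w, by omega⟩, ?_⟩
    unfold collapse
    split_ifs <;> simp only at * <;> omega
  · refine ⟨⟨(x + n - w - 1).toNat, by omega⟩, ?_⟩
    unfold collapse
    split_ifs <;> simp only at * <;> omega

/-- A section of `collapse` through a given index. -/
theorem exists_section (h : 2 * w < n) (a : Fin n) :
    ∃ s : ℤ → Fin n, (∀ x, -(w : ℤ) ≤ x ∧ x ≤ w → collapse n w (s x) = x) ∧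
      s (collapse n w a) = a := by
  classical
  have hex : ∀ x : ℤ, ∃ b, (-(w : ℤ) ≤ x ∧ x ≤ w → collapse n w b = x) ∧
      (x = collapse n w a → b = a) := by
    intro x
    by_cases hxa : x = collapse n w a
    · exact ⟨a, fun _ => hxa.symm, fun _ => rfl⟩
    · by_cases hx : -(w : ℤ) ≤ x ∧ x ≤ w
      · obtain ⟨b, hb⟩ := exists_collapse_eq h hx
        exact ⟨b, fun _ => hb, fun h' => absurd h' hxa⟩
      · exact ⟨a, fun h' => absurd h' hx, fun _ => rfl⟩
  choose s hs using hex
  exact ⟨s, fun x => (hs x).1, (hs _).2 rfl⟩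

theorem card_collapse_ne_zero_le (n w : ℕ) :
    (Finset.univ.filter fun a : Fin n => collapse n w a ≠ 0).card ≤ 2 * w := by
  calc _ ≤ ((Finset.Icc (-(w : ℤ)) w).erase 0).card := by
        refine Finset.card_le_card_of_injOn (collapse n w) (fun a ha => ?_) fun a ha b _ hab => ?_
        · have h1 := (Finset.mem_filter.1 (Finset.mem_coe.1 ha)).2
          exact Finset.mem_coe.2
            (Finset.mem_erase.2 ⟨h1, Finset.mem_Icc.2 (collapse_bounds a)⟩)
        · exact collapse_injOn (Finset.mem_filter.1 (Finset.mem_coe.1 ha)).2 hab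
    _ = 2 * w := by
        rw [Finset.card_erase_of_mem (by simp), Int.card_Icc]
        omega

theorem Contains.mono {m n p q : ℕ} {A B : ZeroOneMatrix m n} {P : ZeroOneMatrix p q}
    (h : Contains A P) (hAB : ∀ i j, A i j = true → B i j = true) : Contains B P := by
  obtain ⟨r, c, hr, hc, h⟩ := h
  exact ⟨r, c, hr, hc, fun i j hij => hAB _ _ (h i j hij)⟩

/-- A matrix avoiding `P` extends to a matrix saturating for `P`. -/
theorem Avoids.exists_saturating {m n p q : ℕ} {M : ZeroOneMatrix m n} {P : ZeroOneMatrix p q}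
    (hM : Avoids M P) :
    ∃ A : ZeroOneMatrix m n, Saturating A P ∧ ∀ i j, M i j = true → A i j = true := by
  obtain ⟨A, ⟨hA, hMA⟩, hmax⟩ := Set.exists_max_image
    {A : ZeroOneMatrix m n | Avoids A P ∧ ∀ i j, M i j = true → A i j = true} numOnes
    (Set.toFinite _) ⟨M, hM, fun _ _ h => h⟩
  refine ⟨A, ⟨hA, fun i j hij => ?_⟩, hMA⟩
  by_contra hc
  have hle := hmax (setOne A i j) ⟨hc, fun a b h => by simp [setOne, hMA a b h]⟩
  have hlt : numOnes A < numOnes (setOne A i j) := by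
    apply Finset.card_lt_card
    refine Finset.ssubset_iff_of_subset ?_ |>.2 ⟨(i, j), ?_, ?_⟩
    · intro x hx
      simp only [Finset.mem_filter, Finset.mem_univ, true_and] at hx ⊢
      simp [setOne, hx]
    · simp [setOne]
    · simp [hij]
  omega

theorem sat_le_of_saturating {p q : ℕ} {P : ZeroOneMatrix p q} {A : ZeroOneMatrix n n}
    (hA : Saturating A P) : sat n P ≤ numOnes A :=
  Nat.sInf_le ⟨A, hA, rfl⟩

theorem numOnes_le_of_rows_cols {A : ZeroOneMatrix n n} (R : Finset (Fin n))
    (h : ∀ i j, A i j = true → i ∈ R ∧ j ∈ R) : numOnes A ≤ R.card ^ 2 := by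
  rw [sq, ← Finset.card_product]
  refine Finset.card_le_card fun x hx => ?_
  exact Finset.mem_product.2 (h _ _ (Finset.mem_filter.1 hx).2)

/-- A set of lattice points that avoids `P` and in which any new point on an empty central row or
column creates `P` yields a bound on the saturation function. -/
theorem sat_le_of_not_occursIn (hP : P.IsPermMatrix) {S : Set (ℤ × ℤ)}
    (hS0 : ∀ x ∈ S, x.1 ≠ 0 ∧ x.2 ≠ 0) (hS : ¬ OccursIn P S)
    (hrow : ∀ y : ℤ, -(w : ℤ) ≤ y ∧ y ≤ w → OccursInBox P w (insert (0, y) S))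
    (hcol : ∀ x : ℤ, -(w : ℤ) ≤ x ∧ x ≤ w → OccursInBox P w (insert (x, 0) S)) (n : ℕ) :
    sat n P ≤ (2 * w) ^ 2 := by
  classical
  set φ := collapse n w with hφ
  by_cases hn : 2 * w < n
  · let M : ZeroOneMatrix n n := fun a b => decide ((φ a, φ b) ∈ S)
    have hM : Avoids M P := by
      rintro ⟨r, c, hr, hc, h⟩
      have h' : ∀ i j, P i j = true → (φ (r i), φ (c j)) ∈ S := fun i j hij =>
        of_decide_eq_true (h i j hij)
      -- Only the class of 0 is collapsed, and points of `S` avoid it in both coordinates, so strict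
      -- monotonicity survives.
      refine hS ⟨fun i => φ (r i), fun j => φ (c j), ?_, ?_, h'⟩
      · refine fun i i' hi => lt_of_le_of_ne (collapse_monotone n w (hr hi).le) fun heq => ?_
        obtain ⟨j, hj, -⟩ := hP.1 i
        exact (hr hi).ne (collapse_injOn (hS0 _ (h' i j hj)).1 heq)
      · refine fun j j' hj => lt_of_le_of_ne (collapse_monotone n w (hc hj).le) fun heq => ?_
        obtain ⟨i, hi, -⟩ := hP.2 j
        exact (hc hj).ne (collapse_injOn (hS0 _ (h' i j hi)).2 heq)
    have hadd : ∀ a b, OccursInBox P w (insert (φ a, φ b) S) → Contains (setOne M a b) P := by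
      rintro a b ⟨f, g, hf, hg, hfw, hgw, h⟩
      -- The representative of the central class has to be the very index where the new one was
      -- placed.
      obtain ⟨s, hs, hsa⟩ := exists_section hn a
      obtain ⟨s', hs', hsb⟩ := exists_section hn b
      refine ⟨fun i => s (f i), fun j => s' (g j), fun i i' hi => ?_, fun j j' hj => ?_,
        fun i j hij => ?_⟩
      · by_contra hc
        have := collapse_monotone n w (not_lt.1 hc)
        rw [hs _ (hfw _), hs _ (hfw _)] at this
        exact absurd (hf hi) (not_lt.2 this)
      · by_contra hc
        have := collapse_monotone n w (not_lt.1 hc)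
        rw [hs' _ (hgw _), hs' _ (hgw _)] at this
        exact absurd (hg hj) (not_lt.2 this)
      · rcases h i j hij with h' | h'
        · obtain ⟨h1, h2⟩ := Prod.mk.inj h'
          simp [setOne, h1, h2, hφ, hsa, hsb]
        · have : M (s (f i)) (s' (g j)) = true := by
            simp only [M, hφ, hs _ (hfw _), hs' _ (hgw _), decide_eq_true_eq]
            exact h'
          simp [setOne, this]
    obtain ⟨A, hA, hMA⟩ := hM.exists_saturating
    -- A one of `A` in a central row or column could be added to `M` inside `A`, and would already
    -- create `P`.
    have key : ∀ a b, A a b = true → φ a ≠ 0 ∧ φ b ≠ 0 := by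
      intro a b hab
      by_contra hc
      refine hA.1 (Contains.mono (hadd a b ?_) fun i j hij => ?_)
      · by_cases ha : φ a = 0
        · rw [ha]
          exact hrow _ (collapse_bounds b)
        · have hb : φ b = 0 := by
            by_contra hb
            exact hc ⟨ha, hb⟩
          rw [hb]
          exact hcol _ (collapse_bounds a)
      · unfold setOne at hij
        split_ifs at hij with h
        · rw [h.1, h.2, hab]
        · exact hMA _ _ hij
    calc sat n P ≤ numOnes A := sat_le_of_saturating hA
      _ ≤ (Finset.univ.filter fun a : Fin n => φ a ≠ 0).card ^ 2 :=
          numOnes_le_of_rows_cols _ fun i j hij => by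
            simpa using key i j hij
      _ ≤ (2 * w) ^ 2 := Nat.pow_le_pow_left (card_collapse_ne_zero_le n w) 2
  -- For `n ≤ 2w` the bound is just the number of entries; avoidance by the zero matrix only serves
  -- to show that a saturating matrix exists.
  · have hM : Avoids (fun _ _ => false : ZeroOneMatrix n n) P := by
      rintro ⟨r, c, hr, hc, h⟩
      obtain ⟨f, g, hf, hg, -, -, h'⟩ := hrow 0 (by omega)
      refine hS ⟨f, g, hf, hg, fun i j hij => ?_⟩
      exact absurd (h i j hij) (by simp)
    obtain ⟨A, hA, -⟩ := hM.exists_saturating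
    calc sat n P ≤ numOnes A := sat_le_of_saturating hA
      _ ≤ (Finset.univ : Finset (Fin n)).card ^ 2 :=
          numOnes_le_of_rows_cols _ fun i j _ => by simp
      _ ≤ (2 * w) ^ 2 := Nat.pow_le_pow_left (by rw [Finset.card_fin]; omega) 2

/-! ### The quadratic bound -/

theorem sat_one_eq_zero {P : ZeroOneMatrix 1 1} (hP : P.IsPermMatrix) (n : ℕ) :
    sat n P = 0 := by
  obtain ⟨⟨A, hA, hn⟩, -⟩ := sat_isLeast n P ⟨0, (hP.1 0).exists⟩
  rw [← hn, numOnes, Finset.card_eq_zero, Finset.filter_eq_empty_iff]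
  exact fun x _ hx => hA.1 ⟨fun _ => x.1, fun _ => x.2, Subsingleton.strictMono _,
    Subsingleton.strictMono _, fun _ _ _ => hx⟩

theorem IsOrdinary.sat_le (hP : P.IsOrdinary) (hk : 0 < k) (n : ℕ) :
    sat n P ≤ 36 * k ^ 2 := by
  obtain rfl | hk2 : k = 1 ∨ 2 ≤ k := by omega
  · rw [sat_one_eq_zero hP.1]
    exact Nat.zero_le _
  obtain ⟨z, hz⟩ : ∃ z : Fin k, z.val = 0 := ⟨⟨0, hk⟩, rfl⟩
  obtain ⟨e, he⟩ : ∃ e : Fin k, e.val + 1 = k := ⟨⟨k - 1, by omega⟩, by simp only; omega⟩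
  obtain ⟨r, hr, -⟩ := hP.1.2 e
  obtain ⟨l, hl, -⟩ := hP.1.2 z
  obtain ⟨b, hb, -⟩ := hP.1.1 e
  obtain ⟨t, ht, -⟩ := hP.1.1 z
  have h := sat_le_of_not_occursIn hP.1 (S := crossSet P r l b t) (w := 3 * k) ?_
    (hP.not_occursIn_crossSet hk2 he hr hz hl hb ht)
    (fun y hy => occursInBox_insert_row hP.1 he hr hz hl hy)
    (fun x hx => occursInBox_insert_col hP.1 he hz hb ht hx) n
  · calc sat n P ≤ (2 * (3 * k)) ^ 2 := h
      _ = 36 * k ^ 2 := by ring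
  · rintro ⟨x, y⟩ (h | h | h | h)
    · have := armIn_bounds hP.1 he hr h
      omega
    · have := armOut_bounds hP.1 hz hl h
      omega
    · have := armIn_bounds hP.1.transpose he hb h
      omega
    · have := armOut_bounds hP.1.transpose hz ht h
      omega

end ZeroOneMatrix

/-- Every ordinary permutation matrix has a bounded saturation function; moreover the bound is
quadratic in the size of the matrix, with an absolute constant. -/
theorem theorem2 :
    (∀ (k : ℕ) (P : ZeroOneMatrix k k), 0 < k → P.IsOrdinary →
      (fun n : ℕ => (P.sat n : ℝ)) =O[atTop] (fun _ : ℕ => (1 : ℝ))) ∧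
    ∃ K : ℕ, ∀ (k : ℕ) (P : ZeroOneMatrix k k), 0 < k → P.IsOrdinary →
      ∀ n : ℕ, P.sat n ≤ K * k ^ 2 := by
  refine ⟨fun k P hk hP => ?_, 36, fun k P hk hP => hP.sat_le hk⟩
  refine IsBigO.of_bound ((36 * k ^ 2 : ℕ) : ℝ) (Eventually.of_forall fun n => ?_)
  rw [norm_one, mul_one, Real.norm_of_nonneg (Nat.cast_nonneg _)]
  exact Nat.cast_le.2 (hP.sat_le hk n)
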